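/- A metric space \((M,d)\) has the long trapezoid property (LTP) if for every finite subset \(N\subseteq M\) and every \(\varepsilon>0\) there exist \(u,v\in M\) with \(u\neq v\) such that \[ (1-\varepsilon)\bigl(d(x,y)+d(u,v)\bigr)\le d(x,u)+d(y,v)\qquad\text{for all } x,y\in N . \] Subsets of \(M\) are regarded as metric spaces with the restricted metric. **Proposition.** Let \((M,d)\) be a metric space. Then: (1) Assume that \(M\) is the \(\ell_1\)-sum of two of its subsets \(T_1,T_2\), glued at a point \(0\in M\), i.e. \(M=T_1\cup T_2\), \(T_1\cap T_2=\{0\}\), and \[ d(x,y)=d(x,0)+d(0,y)\qquad\text{for every } x\in T_1 \text{ and every } y\in T_2 . \] Then \(M\) has the LTP if and only if \(T_1\) or \(T_2\) has the LTP. (2) If \(M\) has the LTP and \(N_1\) is a subset of \(M\) such that \(M\setminus N_1\) is finite, then \(N_1\) has the LTP. -/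

import Mathlib

/-- The long trapezoid property (LTP) of a metric space `M`. The finite set `N` may be empty, so a
space with the LTP has at least two points. -/
def HasLTP (M : Type*) [MetricSpace M] : Prop :=
  ∀ (N : Finset M) (ε : ℝ), 0 < ε →
    ∃ u v : M, u ≠ v ∧
      ∀ x ∈ N, ∀ y ∈ N, (1 - ε) * (dist x y + dist u v) ≤ dist x u + dist y v

/-- The metric space `M` is the `ℓ₁`-sum of its subsets `T₁` and `T₂`, glued at the point `z`
(the point written `0` in a pointed metric space). -/
structure IsEllOneSum {M : Type*} [MetricSpace M] (T₁ T₂ : Set M) (z : M) : Prop where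
  union_eq : T₁ ∪ T₂ = Set.univ
  inter_eq : T₁ ∩ T₂ = {z}
  dist_eq : ∀ x ∈ T₁, ∀ y ∈ T₂, dist x y = dist x z + dist z y

/-! For (1), a pair in one summand works for all of `M`, since the other summand is seen only
through `z`. Conversely, if a pair is split between the summands, `z` and the endpoint farther from
`z` form a pair with doubled defect. For (2), if no pair fits in `S`, pigeonhole on the finite
complement fixes one endpoint `u` that serves every finite set and defect. Varying the other
endpoint gives distinct `v`, `w` in `S`, both seen from `N` almost through `u`; they form a pair
themselves. -/

section LongTrapezoid

variable {M : Type*} [MetricSpace M]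

/-- The points `u ≠ v` satisfy the long trapezoid inequality with defect `ε` over the set `N`. -/
def TrapezoidPair (N : Set M) (ε : ℝ) (u v : M) : Prop :=
  u ≠ v ∧ ∀ x ∈ N, ∀ y ∈ N, (1 - ε) * (dist x y + dist u v) ≤ dist x u + dist y v

theorem TrapezoidPair.symm {N : Set M} {ε : ℝ} {u v : M} (h : TrapezoidPair N ε u v) :
    TrapezoidPair N ε v u := by
  refine ⟨h.1.symm, fun x hx y hy => ?_⟩
  have := h.2 y hy x hx
  rw [dist_comm x y, dist_comm v u]
  linarith

theorem TrapezoidPair.mono {N N' : Set M} {ε ε' : ℝ} {u v : M} (h : TrapezoidPair N' ε' u v)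
    (hN : N ⊆ N') (hε : ε' ≤ ε) : TrapezoidPair N ε u v := by
  refine ⟨h.1, fun x hx y hy => le_trans ?_ (h.2 x (hN hx) y (hN hy))⟩
  gcongr

theorem hasLTP_iff_trapezoidPair :
    HasLTP M ↔ ∀ N : Set M, N.Finite → ∀ ε : ℝ, 0 < ε → ε < 1 →
      ∃ u v : M, TrapezoidPair N ε u v := by
  constructor
  · intro h N hN ε hε _
    obtain ⟨u, v, huv, H⟩ := h hN.toFinset ε hε
    exact ⟨u, v, huv, fun x hx y hy => H x (by simpa using hx) y (by simpa using hy)⟩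
  · intro h N ε hε
    obtain ⟨u, v, H⟩ := h N N.finite_toSet (min ε (1 / 2)) (by positivity)
      ((min_le_right _ _).trans_lt (by norm_num))
    have H' := H.mono subset_rfl (min_le_left ε (1 / 2))
    exact ⟨u, v, H'.1, fun x hx y hy => H'.2 x hx y hy⟩

theorem hasLTP_coe_iff_trapezoidPair {S : Set M} :
    HasLTP S ↔ ∀ N : Set M, N.Finite → N ⊆ S → ∀ ε : ℝ, 0 < ε → ε < 1 →
      ∃ u ∈ S, ∃ v ∈ S, TrapezoidPair N ε u v := by
  rw [hasLTP_iff_trapezoidPair]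
  constructor
  · intro h N hN hNS ε h0 h1
    obtain ⟨u, v, huv, H⟩ :=
      h (Subtype.val ⁻¹' N) (hN.preimage Subtype.val_injective.injOn) ε h0 h1
    exact ⟨u, u.2, v, v.2, fun e => huv (Subtype.ext e),
      fun x hx y hy => H ⟨x, hNS hx⟩ hx ⟨y, hNS hy⟩ hy⟩
  · intro h N hN ε h0 h1
    obtain ⟨u, hu, v, hv, huv, H⟩ := h (Subtype.val '' N) (hN.image _)
      (by rintro _ ⟨x, -, rfl⟩; exact x.2) ε h0 h1
    exact ⟨⟨u, hu⟩, ⟨v, hv⟩, fun e => huv (congrArg Subtype.val e),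
      fun x hx y hy => H x ⟨x, hx, rfl⟩ y ⟨y, hy, rfl⟩⟩

/-- If all paths from `N` to `u` almost pass through `z`, then `z` and `u` form a trapezoid pair. -/
theorem TrapezoidPair.of_almost_between {N : Set M} {ε : ℝ} {z u : M} (h0 : 0 < ε) (h1 : ε < 1)
    (hzu : z ≠ u) (h : ∀ y ∈ N, (1 - ε) * (dist y z + dist z u) ≤ dist y u) :
    TrapezoidPair N ε z u := by
  refine ⟨hzu, fun x hx y hy => ?_⟩
  have hy' := h y hy
  have ht : (1 - ε) * dist x y ≤ (1 - ε) * (dist x z + dist y z) :=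
    mul_le_mul_of_nonneg_left (dist_triangle_right x y z) (by linarith)
  have hε : 0 ≤ ε * dist x z := by positivity
  linarith

/-- If all paths from `N` to `v` and to `w` almost pass through `u`, then `v` and `w` form a
trapezoid pair. -/
theorem TrapezoidPair.of_almost_between_of_almost_between {N : Set M} {ε : ℝ} {u v w : M}
    (h1 : ε < 1) (hvw : v ≠ w) (hv : ∀ y ∈ N, (1 - ε) * (dist y u + dist u v) ≤ dist y v)
    (hw : ∀ y ∈ N, (1 - ε) * (dist y u + dist u w) ≤ dist y w) :
    TrapezoidPair N ε v w := by
  refine ⟨hvw, fun x hx y hy => ?_⟩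
  have hx' := hv x hx
  have hy' := hw y hy
  have h : (1 - ε) * (dist x y + dist v w) ≤
      (1 - ε) * ((dist x u + dist y u) + (dist u v + dist u w)) :=
    mul_le_mul_of_nonneg_left
      (add_le_add (dist_triangle_right x y u) (dist_triangle_left v w u)) (by linarith)
  linarith

theorem TrapezoidPair.not_mem_of_mem {N : Set M} {ε : ℝ} {u v : M} (h : TrapezoidPair N ε u v)
    (h1 : ε < 1) (hu : u ∈ N) : v ∉ N := by
  intro hv
  have h' := h.2 u hu v hv
  have hd := mul_pos (sub_pos.2 h1) (dist_pos.2 h.1)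
  simp only [dist_self] at h'
  linarith

theorem TrapezoidPair.almost_between {N : Set M} {ε : ℝ} {u v : M} (h : TrapezoidPair N ε u v)
    (hu : u ∈ N) {y : M} (hy : y ∈ N) : (1 - ε) * (dist y u + dist u v) ≤ dist y v := by
  have h' := h.2 u hu y hy
  rw [dist_self, zero_add, dist_comm u y] at h'
  exact h'

theorem IsEllOneSum.symm {T₁ T₂ : Set M} {z : M} (h : IsEllOneSum T₁ T₂ z) :
    IsEllOneSum T₂ T₁ z where
  union_eq := by rw [Set.union_comm, h.union_eq]
  inter_eq := by rw [Set.inter_comm, h.inter_eq]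
  dist_eq x hx y hy := by
    rw [dist_comm x y, h.dist_eq y hy x hx, dist_comm x z, dist_comm z y, add_comm]

theorem IsEllOneSum.hasLTP_of_left {T₁ T₂ : Set M} {z : M} (h : IsEllOneSum T₁ T₂ z)
    (hT : HasLTP T₁) : HasLTP M := by
  rw [hasLTP_iff_trapezoidPair]
  rw [hasLTP_coe_iff_trapezoidPair] at hT
  intro N hN ε h0 h1
  have hz : z ∈ T₁ := (h.inter_eq.symm ▸ Set.mem_singleton z : z ∈ T₁ ∩ T₂).1
  obtain ⟨u, hu, v, hv, huv, H⟩ := hT (insert z (N ∩ T₁)) ((hN.inter_of_left _).insert z)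
    (Set.insert_subset hz Set.inter_subset_right) ε h0 h1
  -- A point of `T₂` is seen from `T₁` through `z`.
  have key : ∀ x ∈ N, ∃ p ∈ insert z (N ∩ T₁), ∀ w ∈ T₁, dist x w = dist x p + dist p w := by
    intro x hx
    rcases (h.union_eq.symm ▸ Set.mem_univ x : x ∈ T₁ ∪ T₂) with hx1 | hx2
    · exact ⟨x, Or.inr ⟨hx, hx1⟩, fun w _ => by simp⟩
    · exact ⟨z, Or.inl rfl, fun w hw => h.symm.dist_eq x hx2 w hw⟩
  refine ⟨u, v, huv, fun x hx y hy => ?_⟩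
  obtain ⟨p, hp, hxp⟩ := key x hx
  obtain ⟨q, hq, hyq⟩ := key y hy
  rw [hxp u hu, hyq v hv]
  have hpq := H p hp q hq
  have ht : (1 - ε) * dist x y ≤ (1 - ε) * (dist x p + dist p q + dist y q) :=
    mul_le_mul_of_nonneg_left
      (by simpa only [dist_comm y q] using dist_triangle4 x p q y) (by linarith)
  have hε : 0 ≤ ε * (dist x p + dist y q) := by positivity
  linarith

/-- A trapezoid pair split between the two summands yields one inside the summand containing the
endpoint farther from the gluing point. -/
theorem IsEllOneSum.trapezoidPair_of_dist_le {T₁ T₂ : Set M} {z : M} (h : IsEllOneSum T₁ T₂ z)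
    {N : Set M} {ε : ℝ} (h0 : 0 < ε) (h1 : 2 * ε < 1) (hz : z ∈ N) {u v : M} (hu : u ∈ T₁)
    (hv : v ∈ T₂) (huv : TrapezoidPair N ε u v) (hd : dist z v ≤ dist z u) :
    TrapezoidPair N (2 * ε) z u := by
  refine .of_almost_between (by linarith) h1 ?_ fun y hy => ?_
  · rintro rfl
    rw [dist_self] at hd
    exact huv.1 (dist_le_zero.1 hd)
  -- Since `d(u,v) = d(u,z) + d(z,v)`, the test at `(y, z)` leaves an excess `ε * d(z,v)`, at most
  -- `ε * d(z,u)`: hence the factor 2.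
  · have hy' := huv.2 y hy z hz
    rw [h.dist_eq u hu v hv, dist_comm u z] at hy'
    have hε : ε * dist z v ≤ ε * dist z u := mul_le_mul_of_nonneg_left hd h0.le
    have hε' : 0 ≤ ε * dist y z := by positivity
    linarith

theorem IsEllOneSum.hasLTP_left_or_right {T₁ T₂ : Set M} {z : M} (h : IsEllOneSum T₁ T₂ z)
    (hM : HasLTP M) : HasLTP T₁ ∨ HasLTP T₂ := by
  rw [hasLTP_iff_trapezoidPair] at hM
  rw [hasLTP_coe_iff_trapezoidPair, hasLTP_coe_iff_trapezoidPair]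
  obtain ⟨hz1, hz2⟩ : z ∈ T₁ ∩ T₂ := h.inter_eq.symm ▸ Set.mem_singleton z
  by_contra! hcon
  obtain ⟨⟨N₁, hN₁, -, ε₁, hε₁, hε₁', H₁⟩, ⟨N₂, hN₂, -, ε₂, hε₂, -, H₂⟩⟩ := hcon
  set N := insert z (N₁ ∪ N₂)
  have hzN : z ∈ N := Set.mem_insert _ _
  have hsub₁ : N₁ ⊆ N := Set.subset_union_left.trans (Set.subset_insert _ _)
  have hsub₂ : N₂ ⊆ N := Set.subset_union_right.trans (Set.subset_insert _ _)
  obtain ⟨ε, h0, h1, h2⟩ : ∃ ε : ℝ, 0 < ε ∧ 2 * ε ≤ ε₁ ∧ 2 * ε ≤ ε₂ :=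
    ⟨min ε₁ ε₂ / 2, by positivity, by linarith [min_le_left ε₁ ε₂],
      by linarith [min_le_right ε₁ ε₂]⟩
  have hε : 2 * ε < 1 := h1.trans_lt hε₁'
  have mixed : ∀ u ∈ T₁, ∀ v ∈ T₂, ¬ TrapezoidPair N ε u v := by
    intro u hu v hv huv
    rcases le_total (dist z v) (dist z u) with hd | hd
    · exact H₁ z hz1 u hu ((h.trapezoidPair_of_dist_le h0 hε hzN hu hv huv hd).mono hsub₁ h1)
    · exact H₂ z hz2 v hv
        ((h.symm.trapezoidPair_of_dist_le h0 hε hzN hv hu huv.symm hd).mono hsub₂ h2)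
  obtain ⟨u, v, huv⟩ := hM N ((hN₁.union hN₂).insert z) ε h0 (by linarith)
  rcases (h.union_eq.symm ▸ Set.mem_univ u : u ∈ T₁ ∪ T₂) with hu | hu <;>
    rcases (h.union_eq.symm ▸ Set.mem_univ v : v ∈ T₁ ∪ T₂) with hv | hv
  · exact H₁ u hu v hv (huv.mono hsub₁ (by linarith))
  · exact mixed u hu v hv huv
  · exact mixed v hv u hu huv.symm
  · exact H₂ u hu v hv (huv.mono hsub₂ (by linarith))

/-- If, for every finite set and every defect, some trapezoid pair has an endpoint in the finite
set `F`, then that endpoint can be chosen independently of the finite set and of the defect. -/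
theorem exists_mem_forall_trapezoidPair {F : Set M} (hF : F.Finite)
    (h : ∀ N : Set M, N.Finite → ∀ ε : ℝ, 0 < ε → ε < 1 →
      ∃ u ∈ F, ∃ v, TrapezoidPair N ε u v) :
    ∃ u ∈ F, ∀ N : Set M, N.Finite → ∀ ε : ℝ, 0 < ε → ε < 1 → ∃ v, TrapezoidPair N ε u v := by
  by_contra! hcon
  choose! N hN ε h0 h1 H using hcon
  obtain ⟨δ, hδ0, hδ1, hδ⟩ : ∃ δ : ℝ, 0 < δ ∧ δ < 1 ∧ ∀ u ∈ F, δ ≤ ε u := by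
    rcases F.eq_empty_or_nonempty with rfl | hne
    · exact ⟨1 / 2, by norm_num, by norm_num, by simp⟩
    · obtain ⟨u, hu, hmin⟩ := F.exists_min_image ε hF hne
      exact ⟨ε u, h0 u hu, h1 u hu, hmin⟩
  -- One pair for the union of all the counterexample sets, with the least defect, refutes the
  -- counterexample of its own endpoint.
  obtain ⟨u, hu, v, huv⟩ := h (⋃ u ∈ F, N u) (hF.biUnion hN) δ hδ0 hδ1
  exact H u hu v (huv.mono (Set.subset_biUnion_of_mem hu) (hδ u hu))

theorem HasLTP.of_finite_compl (hM : HasLTP M) {S : Set M} (hS : Sᶜ.Finite) : HasLTP S := by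
  rw [hasLTP_iff_trapezoidPair] at hM
  rw [hasLTP_coe_iff_trapezoidPair]
  by_contra! hcon
  obtain ⟨N, hN, -, ε, h0, h1, H⟩ := hcon
  obtain ⟨u, hu, Hu⟩ := exists_mem_forall_trapezoidPair hS fun N' hN' ε' h0' h1' => by
    obtain ⟨u, v, huv⟩ := hM (N ∪ N') (hN.union hN') (min ε ε') (lt_min h0 h0')
      ((min_le_left _ _).trans_lt h1)
    have huv' := huv.mono Set.subset_union_right (min_le_right ε ε')
    by_cases hu : u ∈ S
    · by_cases hv : v ∈ S
      · exact absurd (huv.mono Set.subset_union_left (min_le_left ε ε')) (H u hu v hv)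
      · exact ⟨v, hv, u, huv'.symm⟩
    · exact ⟨u, hu, v, huv'⟩
  have tip : ∀ N' : Set M, N'.Finite → ∃ v ∈ S, v ∉ N' ∧
      ∀ y ∈ N, (1 - ε) * (dist y u + dist u v) ≤ dist y v := by
    intro N' hN'
    -- As `u ∈ Sᶜ` is in the test set, `v` is not: this puts `v` in `S` and off `N'`.
    obtain ⟨v, huv⟩ := Hu (N ∪ N' ∪ Sᶜ) ((hN.union hN').union hS) ε h0 h1
    have hv := huv.not_mem_of_mem h1 (Or.inr hu)
    exact ⟨v, by_contra fun hvS => hv (Or.inr hvS), fun hvN => hv (Or.inl (Or.inr hvN)),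
      fun y hy => huv.almost_between (Or.inr hu) (Or.inl (Or.inl hy))⟩
  obtain ⟨v, hvS, -, hv⟩ := tip ∅ Set.finite_empty
  obtain ⟨w, hwS, hwv, hw⟩ := tip {v} (Set.finite_singleton v)
  exact H v hvS w hwS (.of_almost_between_of_almost_between h1 (fun e => hwv e.symm) hv hw)

end LongTrapezoid

theorem proposition3p6 {M : Type*} [MetricSpace M] :
    (∀ (T₁ T₂ : Set M) (z : M), IsEllOneSum T₁ T₂ z →
      (HasLTP M ↔ HasLTP T₁ ∨ HasLTP T₂)) ∧
    (∀ N₁ : Set M, HasLTP M → N₁ᶜ.Finite → HasLTP N₁) :=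
  ⟨fun _ _ _ h => ⟨h.hasLTP_left_or_right, fun hT => hT.elim h.hasLTP_of_left h.symm.hasLTP_of_left⟩,
    fun _ hM hN => hM.of_finite_compl hN⟩
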